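/- For complex Hilbert spaces $H_1,H_2$ let $\mathrm{CP}(H_1,H_2)$ be the set of normal (ultraweakly continuous) completely positive linear maps $B(H_1)\to B(H_2)$, and for $S,T\in\mathrm{CP}(H_1,H_2)$ write $S\le T$ if $T-S\in\mathrm{CP}(H_1,H_2)$. Let $S,T\in\mathrm{CP}(H_1,H_2)$. Let $E$ be a Hilbert space and $V:H_2\to H_1\otimes E$ a bounded operator giving a canonical Stinespring dilation of $T$, i.e. $T(A)=V^*(A\otimes 1_E)V$ for all $A\in B(H_1)$ and the vectors $(A\otimes 1_E)V\psi$ ($A\in B(H_1)$, $\psi\in H_2$) are total in $H_1\otimes E$. Let $\{V_x\}_{x\in X}$ be a family of bounded operators $H_2\to H_1$ (Kraus operators of $T$) induced by this dilation, i.e. there is an orthonormal system $\{e_x\}_{x\in X}$ in $E$ with $V\psi=\sum_{x\in X}V_x\psi\otimes e_x$ for all $\psi\in H_2$. Then $S\le T$ if and only if there is a kernel $K:X\times X\to\mathbb C$ with $0\le K\le I$ such that $$S(A)=\sum_{x,y\in X}K(x,y)\,V_x^*AV_y\qquad\text{for all }A\in B(H_1).$$ Here $I(x,y)=\delta_{xy}$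 is the Kronecker kernel; a kernel $K$ is positive-definite, $K\ge 0$, if $\sum_{i,j=1}^n\overline{c_i}c_jK(x_i,x_j)\ge0$ for all $n\in\mathbb N$, $x_i\in X$, $c_i\in\mathbb C$; and $K\le K'$ means $K'-K\ge0$. The double series converges in the strong operator topology, in the sense that its partial sums over finite rectangles $X_0\times Y_0\subseteq X\times X$ converge strongly as the finite sets $X_0,Y_0$ increase. -/

import Mathlib

open Filter Topology
open scoped TensorProduct InnerProductSpace ComplexOrder CStarAlgebra

noncomputable section

/-! ### Normal completely positive maps and their partial order -/

/-- The ultraweak topology on `B(H)`: the coarsest topology that makes all the functionals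
`A ↦ ∑ₙ ⟪ξₙ, A ηₙ⟫` with `∑ₙ ‖ξₙ‖² < ∞` and `∑ₙ ‖ηₙ‖² < ∞` continuous. -/
abbrev ultraweakTopology (H : Type*) [NormedAddCommGroup H] [InnerProductSpace ℂ H] :
    TopologicalSpace (H →L[ℂ] H) :=
  ⨅ (ξ : lp (fun _ : ℕ => H) 2) (η : lp (fun _ : ℕ => H) 2),
    TopologicalSpace.induced (fun A : H →L[ℂ] H => ∑' n, ⟪ξ n, A (η n)⟫_ℂ) inferInstance

/-- The set `CP(H₁, H₂)` of normal (ultraweakly continuous) completely positive linear maps of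
`B(H₁)` into `B(H₂)`. -/
def CP (H₁ H₂ : Type*) [NormedAddCommGroup H₁] [InnerProductSpace ℂ H₁] [CompleteSpace H₁]
    [NormedAddCommGroup H₂] [InnerProductSpace ℂ H₂] [CompleteSpace H₂] :
    Set ((H₁ →L[ℂ] H₁) →ₗ[ℂ] (H₂ →L[ℂ] H₂)) :=
  {T | (∃ Φ : (H₁ →L[ℂ] H₁) →CP (H₂ →L[ℂ] H₂), Φ.toLinearMap = T) ∧
    @Continuous _ _ (ultraweakTopology H₁) (ultraweakTopology H₂) T}

/-- The partial order of `CP(H₁, H₂)`: `S ≤ T` (`S` is completely dominated by `T`) when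
`T - S` belongs to `CP(H₁, H₂)`. -/
def CompletelyDominated {H₁ H₂ : Type*}
    [NormedAddCommGroup H₁] [InnerProductSpace ℂ H₁] [CompleteSpace H₁]
    [NormedAddCommGroup H₂] [InnerProductSpace ℂ H₂] [CompleteSpace H₂]
    (S T : (H₁ →L[ℂ] H₁) →ₗ[ℂ] (H₂ →L[ℂ] H₂)) : Prop :=
  T - S ∈ CP H₁ H₂

/-! ### The canonical Stinespring dilation and the Kraus operators it induces -/

/-- The Hilbert space tensor product `H ⊗ E`: the completion of the algebraic tensor product
with respect to the inner product `⟪a ⊗ b, c ⊗ d⟫ = ⟪a, c⟫ ⟪b, d⟫`. -/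
abbrev HilbertTensor (H E : Type*) [NormedAddCommGroup H] [InnerProductSpace ℂ H]
    [NormedAddCommGroup E] [InnerProductSpace ℂ E] : Type _ :=
  UniformSpace.Completion (H ⊗[ℂ] E)

/-- The elementary tensor `ψ ⊗ χ` as an element of the Hilbert space tensor product. -/
def elemTensor {H E : Type*} [NormedAddCommGroup H] [InnerProductSpace ℂ H]
    [NormedAddCommGroup E] [InnerProductSpace ℂ E] (ψ : H) (χ : E) : HilbertTensor H E :=
  ((ψ ⊗ₜ[ℂ] χ : H ⊗[ℂ] E) : UniformSpace.Completion (H ⊗[ℂ] E))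

/-- The amplification `A ⊗ 1_E` of a bounded operator `A` on `H`: the continuous extension to
the completion of `A ⊗ 1_E` on the algebraic tensor product. -/
def amplification {H : Type*} (E : Type*) [NormedAddCommGroup H] [InnerProductSpace ℂ H]
    [NormedAddCommGroup E] [InnerProductSpace ℂ E] (A : H →L[ℂ] H) :
    HilbertTensor H E →L[ℂ] HilbertTensor H E :=
  ((UniformSpace.Completion.toComplL (𝕜 := ℂ) (E := H ⊗[ℂ] E)) ∘L (A.rTensor E)).extend
    (UniformSpace.Completion.toComplL (𝕜 := ℂ) (E := H ⊗[ℂ] E))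

theorem amplification_coe {H E : Type*} [NormedAddCommGroup H] [InnerProductSpace ℂ H]
    [NormedAddCommGroup E] [InnerProductSpace ℂ E] (A : H →L[ℂ] H) (t : H ⊗[ℂ] E) :
    amplification E A (t : UniformSpace.Completion (H ⊗[ℂ] E)) =
      ((A.rTensor E t : H ⊗[ℂ] E) : UniformSpace.Completion (H ⊗[ℂ] E)) :=
  ContinuousLinearMap.extend_eq _ UniformSpace.Completion.denseRange_coe
    (UniformSpace.Completion.isUniformInducing_coe _) t

theorem amplification_elemTensor {H E : Type*} [NormedAddCommGroup H] [InnerProductSpace ℂ H]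
    [NormedAddCommGroup E] [InnerProductSpace ℂ E] (A : H →L[ℂ] H) (ψ : H) (χ : E) :
    amplification E A (elemTensor ψ χ) = elemTensor (A ψ) χ :=
  amplification_coe A (ψ ⊗ₜ[ℂ] χ)

/-- `V : H₂ → H₁ ⊗ E` gives a canonical Stinespring dilation of `T`: one has
`T(A) = V* (A ⊗ 1_E) V` for all `A`, and the vectors `(A ⊗ 1_E) V ψ` are total in `H₁ ⊗ E`
(minimality). -/
structure IsCanonicalStinespringDilation {H₁ H₂ E : Type*}
    [NormedAddCommGroup H₁] [InnerProductSpace ℂ H₁] [CompleteSpace H₁]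
    [NormedAddCommGroup H₂] [InnerProductSpace ℂ H₂] [CompleteSpace H₂]
    [NormedAddCommGroup E] [InnerProductSpace ℂ E] [CompleteSpace E]
    (T : (H₁ →L[ℂ] H₁) →ₗ[ℂ] (H₂ →L[ℂ] H₂)) (V : H₂ →L[ℂ] HilbertTensor H₁ E) : Prop where
  dilation : ∀ A : H₁ →L[ℂ] H₁,
    T A = (ContinuousLinearMap.adjoint V) ∘L (amplification E A) ∘L V
  minimal : (Submodule.span ℂ
    {v : HilbertTensor H₁ E | ∃ (A : H₁ →L[ℂ] H₁) (ψ : H₂),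
      v = amplification E A (V ψ)}).topologicalClosure = ⊤

/-- The family `W` of operators `W x : H₂ → H₁` is induced by `V : H₂ → H₁ ⊗ E`: for some
orthonormal system `e` in `E` one has `V ψ = ∑ₓ W x ψ ⊗ e x` for all `ψ`. -/
def IsInducedKrausFamily {H₁ H₂ E X : Type*}
    [NormedAddCommGroup H₁] [InnerProductSpace ℂ H₁]
    [NormedAddCommGroup H₂] [InnerProductSpace ℂ H₂]
    [NormedAddCommGroup E] [InnerProductSpace ℂ E]
    (V : H₂ →L[ℂ] HilbertTensor H₁ E) (W : X → H₂ →L[ℂ] H₁) : Prop :=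
  ∃ e : X → E, Orthonormal ℂ e ∧ ∀ ψ : H₂, HasSum (fun x => elemTensor (W x ψ) (e x)) (V ψ)

/-! ### Kernels -/

/-- A kernel `K` on `X` is positive-definite: `∑ᵢⱼ c̄ᵢ cⱼ K(xᵢ, xⱼ) ≥ 0` for all finite families
of points `xᵢ` and scalars `cᵢ`. -/
def IsPosDefKernel {X : Type*} (K : X → X → ℂ) : Prop :=
  ∀ (n : ℕ) (x : Fin n → X) (c : Fin n → ℂ),
    0 ≤ ∑ i, ∑ j, (starRingEnd ℂ) (c i) * c j * K (x i) (x j)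

/-- `K ≤ K'` for kernels: `K' - K` is positive-definite. -/
def KernelLE {X : Type*} (K K' : X → X → ℂ) : Prop :=
  IsPosDefKernel (K' - K)

open Classical in
/-- The Kronecker kernel. -/
def kroneckerKernel (X : Type*) : X → X → ℂ := fun x y => if x = y then 1 else 0

/-- The double series `∑_{x,y} B x y` of operators converges to `R` in the strong operator
topology: its partial sums over the finite rectangles `X₀ × Y₀` converge strongly to `R` as the
finite sets `X₀` and `Y₀` increase. -/
def HasStrongDoubleSum {X H : Type*} [NormedAddCommGroup H] [InnerProductSpace ℂ H]
    (B : X → X → H →L[ℂ] H) (R : H →L[ℂ] H) : Prop :=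
  ∀ η : H, Tendsto (fun p : Finset X × Finset X => ∑ x ∈ p.1, ∑ y ∈ p.2, B x y η)
    atTop (𝓝 (R η))

end

/-!
# Radon–Nikodym theorem for the Kraus representation

Write `J_x φ = φ ⊗ e x` for the isometries of `H₁` into `H₁ ⊗ E` given by the orthonormal system `e`,
so that `V_x = J_x* V`, and `P_s = ∑_{x ∈ s} J_x J_x*` for finite `s` (`truncation`). The `P_s` are
projections that commute with the amplification `A ⊗ 1` and converge strongly to `1` on the range of
`V`; minimality of the dilation extends this to `H₁ ⊗ E`
(`IsCanonicalStinespringDilation.tendsto_truncation`).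

If `S ≤ T`, the kernel `(A, B) ↦ S (A* B)` is positive-definite and has a Kolmogorov decomposition
`k`. Since `T - S` is completely positive, `(A ⊗ 1) V ψ ↦ k_A ψ` is well defined and extends to a
contraction `G` on `H₁ ⊗ E`. Then `R = G* G` satisfies `0 ≤ R ≤ 1`, commutes with the amplification,
and `S(A) = V* R (A ⊗ 1) V` (`IsCanonicalStinespringDilation.exists_radonNikodym`). The operators
`J_x* R J_y` lie in the centre of `B(H₁)`, hence are scalars `K(x, y)`, and the partial sums of
`∑ K(x, y) V_x* A V_y` are `V* P_s R P_t (A ⊗ 1) V`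
(`exists_kernel_of_completelyDominated`). Working with `J_x* R J_y` avoids the computation of the
commutant of the amplification.

Conversely, `T - S` is represented by the positive-definite kernel `I - K`, so that on a positive
matrix `B* B` its quadratic form is a limit of pairings of positive-definite kernels with Gram
matrices, hence nonnegative (`completelyDominated_of_kernel`). That a self-adjoint matrix over `B(H)`
with nonnegative quadratic form is nonnegative for the order of the `C⋆`-algebra of matrices is
`CStarMatrix.nonneg_of_sum_inner_applyVec_nonneg`.
-/

/-! ### Positive matrices over `B(H)` -/

/-- One direction of `CStarAlgebra.nonneg_iff_eq_star_mul_self` with all of its structure derived from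
`NonUnitalCStarAlgebra`: in this form it unifies with the instances on `CStarMatrix`. -/
theorem NonUnitalCStarAlgebra.exists_eq_star_mul_self {A : Type*} [NonUnitalCStarAlgebra A]
    [PartialOrder A] [StarOrderedRing A] {a : A} (ha : 0 ≤ a) : ∃ b : A, a = star b * b :=
  CStarAlgebra.nonneg_iff_eq_star_mul_self.mp ha

/-- A self-adjoint element `a` of a `C⋆`-algebra is nonnegative as soon as its compression by its
negative part `n`, which is `-n ^ 3 = -(c* c)`, vanishes. -/
theorem IsSelfAdjoint.exists_mul_mul_eq_neg_star_mul_self {A : Type*} [NonUnitalCStarAlgebra A]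
    [PartialOrder A] [StarOrderedRing A] {a : A} (ha : IsSelfAdjoint a) :
    ∃ n c : A, star n = n ∧ n * a * n = -(star c * c) ∧ (c = 0 → 0 ≤ a) := by
  have hN0 : 0 ≤ a⁻ := CFC.negPart_nonneg a
  have hNs : star a⁻ = a⁻ := (IsSelfAdjoint.of_nonneg hN0).star_eq
  have hcube : 0 ≤ a⁻ * a⁻ * a⁻ := by
    have := star_left_conjugate_nonneg hN0 a⁻
    rwa [hNs] at this
  obtain ⟨c, hc⟩ := CStarAlgebra.nonneg_iff_eq_star_mul_self.mp hcube
  refine ⟨a⁻, c, hNs, ?_, fun h0 => ?_⟩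
  · have hna : a⁻ * a = -(a⁻ * a⁻) := by
      calc a⁻ * a = a⁻ * (a⁺ - a⁻) := by rw [CFC.posPart_sub_negPart a ha]
        _ = -(a⁻ * a⁻) := by rw [mul_sub, CFC.negPart_mul_posPart, zero_sub]
    rw [hna, neg_mul, hc]
  · have hN3 : a⁻ * a⁻ * a⁻ = 0 := by rw [hc, h0, mul_zero]
    have hN2 : a⁻ * a⁻ = 0 := by
      refine CStarRing.star_mul_self_eq_zero_iff (a⁻ * a⁻) |>.1 ?_
      rw [star_mul, hNs, ← mul_assoc, hN3, zero_mul]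
    refine (CFC.negPart_eq_zero_iff a ha).1 (CStarRing.star_mul_self_eq_zero_iff a⁻ |>.1 ?_)
    rw [hNs, hN2]

namespace CStarMatrix

section ApplyVec

variable {ι H : Type*} [Fintype ι] [NormedAddCommGroup H] [InnerProductSpace ℂ H]

/-- The action of a matrix of operators on a column of vectors. -/
def applyVec (M : CStarMatrix ι ι (H →L[ℂ] H)) (η : ι → H) : ι → H := fun i => ∑ j, M i j (η j)

theorem applyVec_mul (M N : CStarMatrix ι ι (H →L[ℂ] H)) (η : ι → H) :
    applyVec (M * N) η = applyVec M (applyVec N η) := by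
  ext i
  simp only [applyVec, mul_apply, map_sum]
  rw [Finset.sum_comm]
  simp

theorem applyVec_neg (M : CStarMatrix ι ι (H →L[ℂ] H)) (η : ι → H) :
    applyVec (-M) η = -applyVec M η := by
  ext i; simp [applyVec]

theorem eq_zero_of_applyVec_eq_zero {M : CStarMatrix ι ι (H →L[ℂ] H)}
    (h : ∀ η, applyVec M η = 0) : M = 0 := by
  classical
  ext i j v
  have := congrFun (h (Pi.single j v)) i
  rw [applyVec, Finset.sum_eq_single j (fun k _ hk => by simp [Pi.single_eq_of_ne hk])
    (by simp)] at this
  simpa using this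

variable [CompleteSpace H]

theorem sum_inner_applyVec_star (M : CStarMatrix ι ι (H →L[ℂ] H)) (ξ η : ι → H) :
    ∑ i, ⟪ξ i, applyVec (star M) η i⟫_ℂ = ∑ i, ⟪applyVec M ξ i, η i⟫_ℂ := by
  simp only [applyVec, inner_sum, sum_inner, star_apply, ContinuousLinearMap.star_eq_adjoint,
    ContinuousLinearMap.adjoint_inner_right]
  rw [Finset.sum_comm]

theorem sum_inner_star_mul_self (N : CStarMatrix ι ι (H →L[ℂ] H)) (ξ η : ι → H) :
    ∑ i, ⟪ξ i, applyVec (star N * N) η i⟫_ℂ = ∑ i, ⟪applyVec N ξ i, applyVec N η i⟫_ℂ := by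
  rw [applyVec_mul, sum_inner_applyVec_star]

theorem sum_inner_applyVec_nonneg {M : CStarMatrix ι ι (H →L[ℂ] H)} (hM : 0 ≤ M) (η : ι → H) :
    0 ≤ ∑ i, ⟪η i, applyVec M η i⟫_ℂ := by
  obtain ⟨N, rfl⟩ := NonUnitalCStarAlgebra.exists_eq_star_mul_self hM
  rw [sum_inner_star_mul_self]
  exact Finset.sum_nonneg fun i _ => by rw [inner_self_eq_norm_sq_to_K]; positivity

/-- A self-adjoint matrix over `B(H)` with a nonnegative quadratic form is nonnegative in the
`C⋆`-algebra of matrices: on the range of its negative part the form would otherwise be negative. -/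
theorem nonneg_of_sum_inner_applyVec_nonneg {M : CStarMatrix ι ι (H →L[ℂ] H)}
    (hsa : IsSelfAdjoint M) (hM : ∀ η : ι → H, 0 ≤ ∑ i, ⟪η i, applyVec M η i⟫_ℂ) : 0 ≤ M := by
  obtain ⟨N, C, hNs, hC, hpos⟩ := hsa.exists_mul_mul_eq_neg_star_mul_self
  refine hpos (eq_zero_of_applyVec_eq_zero fun η => ?_)
  have h1 := hM (applyVec N η)
  rw [← applyVec_mul, ← sum_inner_applyVec_star, ← applyVec_mul, hNs, ← mul_assoc, hC,
    applyVec_neg] at h1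
  simp only [Pi.neg_apply, inner_neg_right, Finset.sum_neg_distrib] at h1
  rw [sum_inner_star_mul_self] at h1
  have h2 : ∑ i, ‖applyVec C η i‖ ^ 2 ≤ 0 := by
    simpa [inner_self_eq_norm_sq_to_K, ← Complex.ofReal_pow] using (Complex.le_def.1 h1).1
  have h3 := (Finset.sum_eq_zero_iff_of_nonneg (fun i _ => by positivity)).1
    (le_antisymm h2 (Finset.sum_nonneg fun i _ => by positivity))
  ext i
  simpa using h3 i (Finset.mem_univ i)

end ApplyVec

end CStarMatrix

/-! ### Normal completely positive maps -/

theorem summable_inner_lp {H : Type*} [NormedAddCommGroup H] [InnerProductSpace ℂ H]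
    (ξ η : lp (fun _ : ℕ => H) 2) (A : H →L[ℂ] H) :
    Summable fun n => ⟪ξ n, A (η n)⟫_ℂ := by
  have hs (ζ : lp (fun _ : ℕ => H) 2) : Summable fun n => ‖ζ n‖ ^ 2 := by
    simpa using (lp.memℓp ζ).summable (by norm_num)
  refine Summable.of_norm_bounded (g := fun n => ‖A‖ * (‖ξ n‖ ^ 2 + ‖η n‖ ^ 2))
    (((hs ξ).add (hs η)).mul_left _) fun n => ?_
  calc ‖⟪ξ n, A (η n)⟫_ℂ‖ ≤ ‖ξ n‖ * (‖A‖ * ‖η n‖) :=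
        (norm_inner_le_norm _ _).trans (by gcongr; exact A.le_opNorm _)
    _ = ‖A‖ * (‖ξ n‖ * ‖η n‖) := by ring
    _ ≤ ‖A‖ * (‖ξ n‖ ^ 2 + ‖η n‖ ^ 2) := by
        gcongr; nlinarith [sq_nonneg (‖ξ n‖ - ‖η n‖), sq_nonneg (‖ξ n‖ + ‖η n‖)]

theorem continuous_ultraweak_sub {H₁ H₂ : Type*} [NormedAddCommGroup H₁] [InnerProductSpace ℂ H₁]
    [NormedAddCommGroup H₂] [InnerProductSpace ℂ H₂] {S T : (H₁ →L[ℂ] H₁) →ₗ[ℂ] (H₂ →L[ℂ] H₂)}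
    (hS : @Continuous _ _ (ultraweakTopology H₁) (ultraweakTopology H₂) S)
    (hT : @Continuous _ _ (ultraweakTopology H₁) (ultraweakTopology H₂) T) :
    @Continuous _ _ (ultraweakTopology H₁) (ultraweakTopology H₂) (T - S) := by
  let _ := ultraweakTopology H₁
  rw [continuous_iInf_rng] at hS hT ⊢
  intro ξ
  have hSξ := hS ξ
  have hTξ := hT ξ
  rw [continuous_iInf_rng] at hSξ hTξ ⊢
  intro η
  have h1 := continuous_induced_rng.1 (hSξ η)
  have h2 := continuous_induced_rng.1 (hTξ η)
  refine continuous_induced_rng.2 ((h2.sub h1).congr fun A => ?_)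
  refine ((summable_inner_lp ξ η (T A)).tsum_sub (summable_inner_lp ξ η (S A))).symm.trans ?_
  exact tsum_congr fun n => (inner_sub_right (𝕜 := ℂ) (ξ n) (T A (η n)) (S A (η n))).symm

section CPMaps

variable {H₁ H₂ : Type*} [NormedAddCommGroup H₁] [InnerProductSpace ℂ H₁] [CompleteSpace H₁]
  [NormedAddCommGroup H₂] [InnerProductSpace ℂ H₂] [CompleteSpace H₂]
  {S T : (H₁ →L[ℂ] H₁) →ₗ[ℂ] (H₂ →L[ℂ] H₂)}

theorem map_star_of_mem_CP (hS : S ∈ CP H₁ H₂) (A : H₁ →L[ℂ] H₁) : S (star A) = star (S A) := by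
  obtain ⟨⟨Φ, rfl⟩, -⟩ := hS
  exact map_star Φ A

/-- The positivity of `S` on the matrices `(A i)* A j`, which is what the Stinespring construction
uses. -/
theorem sum_inner_nonneg_of_mem_CP (hS : S ∈ CP H₁ H₂) {ι : Type*} [Fintype ι]
    (A : ι → H₁ →L[ℂ] H₁) (ψ : ι → H₂) :
    0 ≤ ∑ i, ∑ j, ⟪ψ i, S (star (A i) * A j) (ψ j)⟫_ℂ := by
  obtain ⟨⟨Φ, rfl⟩, -⟩ := hS
  obtain ⟨M, hMA⟩ : ∃ M : CStarMatrix ι ι (H₁ →L[ℂ] H₁), ∀ i j, M i j = star (A i) * A j :=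
    ⟨CStarMatrix.ofMatrix fun i j => star (A i) * A j, fun _ _ => rfl⟩
  have hM : 0 ≤ M := by
    refine CStarMatrix.nonneg_of_sum_inner_applyVec_nonneg ?_ fun η => ?_
    · refine CStarMatrix.ext fun i j => ?_
      rw [CStarMatrix.star_apply, hMA, hMA, star_mul, star_star]
    · have : ∑ i, ⟪η i, CStarMatrix.applyVec M η i⟫_ℂ = ⟪∑ i, A i (η i), ∑ i, A i (η i)⟫_ℂ := by
        simp only [CStarMatrix.applyVec, inner_sum, sum_inner, hMA]
        rw [Finset.sum_comm]
        simp [ContinuousLinearMap.star_eq_adjoint, ContinuousLinearMap.adjoint_inner_right]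
      rw [this, inner_self_eq_norm_sq_to_K]
      positivity
  have := CStarMatrix.sum_inner_applyVec_nonneg (Φ.map_cstarMatrix_nonneg M hM) ψ
  simp only [CStarMatrix.applyVec, inner_sum, CStarMatrix.map_apply, hMA] at this
  exact this

/-- For `S` and `T` in `CP(H₁, H₂)`, the domination `S ≤ T` only has to be checked on the quadratic
forms of the positive matrices `B* B` over `B(H₁)`. -/
theorem completelyDominated_of_sum_inner_nonneg (hS : S ∈ CP H₁ H₂) (hT : T ∈ CP H₁ H₂)
    (h : ∀ (k : ℕ) (B : CStarMatrix (Fin k) (Fin k) (H₁ →L[ℂ] H₁)) (η : Fin k → H₂),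
      0 ≤ ∑ i, ∑ j, ⟪η i, (T - S) ((star B * B) i j) (η j)⟫_ℂ) :
    CompletelyDominated S T := by
  refine ⟨⟨⟨T - S, fun k M hM => ?_⟩, rfl⟩, continuous_ultraweak_sub hS.2 hT.2⟩
  have hstar (A : H₁ →L[ℂ] H₁) : (T - S) (star A) = star ((T - S) A) := by
    simp [map_star_of_mem_CP hS, map_star_of_mem_CP hT]
  obtain ⟨B, rfl⟩ := NonUnitalCStarAlgebra.exists_eq_star_mul_self hM
  have hsa := IsSelfAdjoint.star_mul_self B
  refine CStarMatrix.nonneg_of_sum_inner_applyVec_nonneg ?_ fun η => ?_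
  · refine CStarMatrix.ext fun i j => ?_
    rw [CStarMatrix.star_apply, CStarMatrix.map_apply, CStarMatrix.map_apply, ← hstar,
      CStarMatrix.star_apply_of_isSelfAdjoint hsa]
  · simpa only [CStarMatrix.applyVec, inner_sum] using! h k B η

end CPMaps

/-! ### Positive-definite kernels -/

section Kernels

variable {X : Type*} {L : X → X → ℂ}

theorem IsPosDefKernel.sum_nonneg (hL : IsPosDefKernel L) (s : Finset X) (c : X → ℂ) :
    0 ≤ ∑ x ∈ s, ∑ y ∈ s, (starRingEnd ℂ) (c x) * c y * L x y := by
  have h := hL s.card (fun i => s.equivFin.symm i) (fun i => c (s.equivFin.symm i))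
  rw [← Finset.sum_coe_sort s, ← s.equivFin.symm.sum_comp]
  convert h using 2 with i
  rw [← Finset.sum_coe_sort s, ← s.equivFin.symm.sum_comp]

theorem IsPosDefKernel.posSemidef (hL : IsPosDefKernel L) (s : Finset X) :
    (Matrix.of fun x y : s => L x y).PosSemidef := by
  classical
  rw [← Matrix.isPositive_toEuclideanLin_iff, LinearMap.isPositive_iff_complex]
  intro v
  let c : X → ℂ := fun x => if hx : x ∈ s then v ⟨x, hx⟩ else 0
  have hc (x : s) : c x = v x := by simp [c]
  have h := hL.sum_nonneg s c
  have hv : ∑ x ∈ s, ∑ y ∈ s, (starRingEnd ℂ) (c x) * c y * L x y =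
      ⟪v, (Matrix.of fun x y : s => L x y).toEuclideanLin v⟫_ℂ := by
    simp only [← Finset.sum_coe_sort s, hc, PiLp.inner_apply, Matrix.toLpLin_apply, Matrix.mulVec,
      dotProduct, Matrix.of_apply, RCLike.inner_apply, Finset.sum_mul]
    exact Finset.sum_congr rfl fun x _ => Finset.sum_congr rfl fun y _ => by ring
  rw [hv] at h
  rw [← inner_conj_symm, (IsSelfAdjoint.of_nonneg h : IsSelfAdjoint (_ : ℂ)).conj_eq]
  exact ⟨(RCLike.nonneg_iff_exists_ofReal.1 h).elim fun r hr => by rw [← hr.2]; simp,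
    (RCLike.nonneg_iff.1 h).1⟩

/-- A positive-definite kernel has nonnegative pairing with every Gram matrix. -/
theorem IsPosDefKernel.sum_mul_inner_nonneg {H : Type*} [NormedAddCommGroup H]
    [InnerProductSpace ℂ H] (hL : IsPosDefKernel L) (s : Finset X) (v : X → H) :
    0 ≤ ∑ x ∈ s, ∑ y ∈ s, L x y * ⟪v x, v y⟫_ℂ := by
  classical
  obtain ⟨C, hC⟩ : ∃ C : Matrix s s ℂ, (Matrix.of fun x y : s => L x y) = star C * C := by
    open scoped MatrixOrder in
    exact CStarAlgebra.nonneg_iff_eq_star_mul_self.mp (hL.posSemidef s).nonneg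
  have hL' (x y : s) : L x y = ∑ k, star (C k x) * C k y := by
    have := congrFun (congrFun hC x) y
    simpa [Matrix.mul_apply] using this
  have : ∑ x ∈ s, ∑ y ∈ s, L x y * ⟪v x, v y⟫_ℂ =
      ∑ k, ⟪∑ x : s, C k x • v x, ∑ x : s, C k x • v x⟫_ℂ := by
    simp only [← Finset.sum_coe_sort s, hL', sum_inner, inner_sum, inner_smul_left,
      inner_smul_right, Finset.sum_mul]
    rw [← Finset.sum_comm_cycle, Finset.sum_comm]
    simp only [Finset.mul_sum]
    exact Finset.sum_congr rfl fun k _ => Finset.sum_congr rfl fun y _ =>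
      Finset.sum_congr rfl fun x _ => by rw [RCLike.star_def]; ring
  rw [this]
  exact Finset.sum_nonneg fun i _ => by rw [inner_self_eq_norm_sq_to_K]; positivity

end Kernels

/-! ### The amplification and the embeddings `φ ↦ φ ⊗ χ` -/

section Amplification

variable {H E : Type*} [NormedAddCommGroup H] [InnerProductSpace ℂ H]
  [NormedAddCommGroup E] [InnerProductSpace ℂ E]

theorem HilbertTensor.induction {p : HilbertTensor H E → Prop} (hp : IsClosed {v | p v})
    (hadd : ∀ u v, p u → p v → p (u + v)) (helem : ∀ φ χ, p (elemTensor φ χ)) (v) : p v := by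
  refine UniformSpace.Completion.induction_on v hp fun t => ?_
  induction t with
  | zero => simpa [elemTensor] using helem 0 0
  | tmul φ χ => exact helem φ χ
  | add s t hs ht => rw [UniformSpace.Completion.coe_add]; exact hadd _ _ hs ht

theorem inner_elemTensor (φ φ' : H) (χ χ' : E) :
    ⟪elemTensor φ χ, elemTensor φ' χ'⟫_ℂ = ⟪φ, φ'⟫_ℂ * ⟪χ, χ'⟫_ℂ := by
  simp [elemTensor]

theorem amplification_one (v : HilbertTensor H E) :
    amplification E (1 : H →L[ℂ] H) v = v := by
  induction v using HilbertTensor.induction with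
  | hp => exact isClosed_eq (by fun_prop) (by fun_prop)
  | hadd u v hu hv => simp [hu, hv]
  | helem φ χ => simp [amplification_elemTensor]

theorem amplification_mul (A B : H →L[ℂ] H) (v : HilbertTensor H E) :
    amplification E (A * B) v = amplification E A (amplification E B v) := by
  induction v using HilbertTensor.induction with
  | hp => exact isClosed_eq (by fun_prop) (by fun_prop)
  | hadd u v hu hv => simp [hu, hv]
  | helem φ χ => simp [amplification_elemTensor]

variable [CompleteSpace H]

theorem inner_amplification_right (A : H →L[ℂ] H) (u v : HilbertTensor H E) :
    ⟪u, amplification E A v⟫_ℂ = ⟪amplification E (star A) u, v⟫_ℂ := by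
  induction u using HilbertTensor.induction with
  | hp => exact isClosed_eq (by fun_prop) (by fun_prop)
  | hadd u u' hu hu' => simp only [map_add, inner_add_left, hu, hu']
  | helem φ χ =>
    induction v using HilbertTensor.induction with
    | hp => exact isClosed_eq (by fun_prop) (by fun_prop)
    | hadd u v hu hv => simp only [map_add, inner_add_right, hu, hv]
    | helem φ' χ' =>
      simp only [amplification_elemTensor, inner_elemTensor, ContinuousLinearMap.star_eq_adjoint,
        ContinuousLinearMap.adjoint_inner_left]

end Amplification

section TensorRight

variable {H E : Type*} [NormedAddCommGroup H] [InnerProductSpace ℂ H]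
  [NormedAddCommGroup E] [InnerProductSpace ℂ E]

/-- The embedding `φ ↦ φ ⊗ χ` of `H` into `H ⊗ E`. -/
noncomputable def tensorRight (H : Type*) [NormedAddCommGroup H] [InnerProductSpace ℂ H] (χ : E) :
    H →L[ℂ] HilbertTensor H E :=
  UniformSpace.Completion.toComplL ∘L (TensorProduct.mkL ℂ H E).flip χ

theorem tensorRight_apply (φ : H) (χ : E) : tensorRight H χ φ = elemTensor φ χ := rfl

theorem amplification_tensorRight (A : H →L[ℂ] H) (χ : E) (φ : H) :
    amplification E A (tensorRight H χ φ) = tensorRight H χ (A φ) :=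
  amplification_elemTensor A φ χ

variable [CompleteSpace H]

theorem adjoint_tensorRight_apply_tensorRight (χ χ' : E) (φ : H) :
    (tensorRight H χ).adjoint (tensorRight H χ' φ) = ⟪χ, χ'⟫_ℂ • φ := by
  refine ext_inner_left ℂ fun φ' => ?_
  rw [ContinuousLinearMap.adjoint_inner_right, tensorRight_apply, tensorRight_apply,
    inner_elemTensor, inner_smul_right, mul_comm]

theorem adjoint_tensorRight_amplification (A : H →L[ℂ] H) (χ : E) (v : HilbertTensor H E) :
    (tensorRight H χ).adjoint (amplification E A v) = A ((tensorRight H χ).adjoint v) := by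
  refine ext_inner_left ℂ fun φ => ?_
  rw [ContinuousLinearMap.adjoint_inner_right, inner_amplification_right,
    amplification_tensorRight, ← ContinuousLinearMap.adjoint_inner_right,
    ContinuousLinearMap.star_eq_adjoint, ContinuousLinearMap.adjoint_inner_left]

end TensorRight

/-! ### Finite truncations along an orthonormal system -/

section Truncation

variable {H E X : Type*} [NormedAddCommGroup H] [InnerProductSpace ℂ H] [CompleteSpace H]
  [NormedAddCommGroup E] [InnerProductSpace ℂ E]

/-- The operator `1 ⊗ P_s` on `H ⊗ E`, where `P_s` is the projection onto the span of the vectors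
`e x`, `x ∈ s`, of an orthonormal system `e`. -/
noncomputable def truncation (H : Type*) [NormedAddCommGroup H] [InnerProductSpace ℂ H]
    [CompleteSpace H] (e : X → E) (s : Finset X) : HilbertTensor H E →L[ℂ] HilbertTensor H E :=
  ∑ x ∈ s, tensorRight H (e x) ∘L (tensorRight H (e x)).adjoint

variable {e : X → E}

theorem truncation_apply (s : Finset X) (v : HilbertTensor H E) :
    truncation H e s v = ∑ x ∈ s, tensorRight H (e x) ((tensorRight H (e x)).adjoint v) := by
  simp [truncation]

theorem inner_truncation_left (s : Finset X) (u v : HilbertTensor H E) :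
    ⟪truncation H e s u, v⟫_ℂ = ⟪u, truncation H e s v⟫_ℂ := by
  simp only [truncation_apply, sum_inner, inner_sum]
  refine Finset.sum_congr rfl fun x _ => ?_
  rw [← ContinuousLinearMap.adjoint_inner_right, ContinuousLinearMap.adjoint_inner_left]

theorem truncation_amplification (s : Finset X) (A : H →L[ℂ] H) (v : HilbertTensor H E) :
    truncation H e s (amplification E A v) = amplification E A (truncation H e s v) := by
  simp [truncation_apply, adjoint_tensorRight_amplification, amplification_tensorRight]

theorem Orthonormal.truncation_truncation (he : Orthonormal ℂ e) (s : Finset X)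
    (v : HilbertTensor H E) : truncation H e s (truncation H e s v) = truncation H e s v := by
  classical
  rw [truncation_apply, truncation_apply]
  refine Finset.sum_congr rfl fun x hx => ?_
  simp [adjoint_tensorRight_apply_tensorRight, orthonormal_iff_ite.1 he, hx]

theorem Orthonormal.norm_truncation_apply_le (he : Orthonormal ℂ e) (s : Finset X)
    (v : HilbertTensor H E) : ‖truncation H e s v‖ ≤ ‖v‖ := by
  have h : ‖truncation H e s v‖ * ‖truncation H e s v‖ ≤ ‖v‖ * ‖truncation H e s v‖ := by
    rw [← inner_self_eq_norm_mul_norm (𝕜 := ℂ), inner_truncation_left, he.truncation_truncation]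
    exact re_inner_le_norm _ _
  by_contra! hlt
  exact absurd h (not_le.2 (by gcongr; exact (norm_nonneg v).trans_lt hlt))

end Truncation

/-! ### Kraus operators induced by a dilation -/

section Kraus

variable {H₁ H₂ E X : Type*} [NormedAddCommGroup H₁] [InnerProductSpace ℂ H₁] [CompleteSpace H₁]
  [NormedAddCommGroup H₂] [InnerProductSpace ℂ H₂]
  [NormedAddCommGroup E] [InnerProductSpace ℂ E]
  {V : H₂ →L[ℂ] HilbertTensor H₁ E} {W : X → H₂ →L[ℂ] H₁} {e : X → E}

/-- The Kraus operators are recovered from `V` as `V_x = J_x* V` with `J_x φ = φ ⊗ e x`. -/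
theorem adjoint_tensorRight_comp_eq_of_hasSum (he : Orthonormal ℂ e)
    (hW : ∀ ψ : H₂, HasSum (fun x => elemTensor (W x ψ) (e x)) (V ψ)) (x : X) (ψ : H₂) :
    (tensorRight H₁ (e x)).adjoint (V ψ) = W x ψ := by
  classical
  have h := (hW ψ).mapL (tensorRight H₁ (e x)).adjoint
  refine h.unique ?_
  convert hasSum_ite_eq x (W x ψ) using 2 with y
  rw [← tensorRight_apply, adjoint_tensorRight_apply_tensorRight, orthonormal_iff_ite.1 he]
  split_ifs with h1 h2 h2
  · simp [h1]
  · exact absurd h1.symm h2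
  · exact absurd h2.symm h1
  · simp

theorem tendsto_truncation_isometry (he : Orthonormal ℂ e)
    (hW : ∀ ψ : H₂, HasSum (fun x => elemTensor (W x ψ) (e x)) (V ψ)) (ψ : H₂) :
    Tendsto (fun s => truncation H₁ e s (V ψ)) atTop (𝓝 (V ψ)) := by
  refine Tendsto.congr (fun s => ?_) (hW ψ)
  simp [truncation_apply, adjoint_tensorRight_comp_eq_of_hasSum he hW, tensorRight_apply]

variable [CompleteSpace H₂] [CompleteSpace E] {T : (H₁ →L[ℂ] H₁) →ₗ[ℂ] (H₂ →L[ℂ] H₂)}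

/-- Minimality of the dilation makes the truncations converge strongly to the identity of
`H₁ ⊗ E`: they are contractions commuting with the amplification, and converge on the range
of `V`. -/
theorem IsCanonicalStinespringDilation.tendsto_truncation
    (hV : IsCanonicalStinespringDilation T V) (he : Orthonormal ℂ e)
    (hW : ∀ ψ : H₂, HasSum (fun x => elemTensor (W x ψ) (e x)) (V ψ)) (v : HilbertTensor H₁ E) :
    Tendsto (fun s => truncation H₁ e s v) atTop (𝓝 v) := by
  have hv : v ∈ closure (Submodule.span ℂ {v : HilbertTensor H₁ E |
      ∃ (A : H₁ →L[ℂ] H₁) (ψ : H₂), v = amplification E A (V ψ)} : Set (HilbertTensor H₁ E)) := by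
    rw [← Submodule.topologicalClosure_coe, hV.minimal]; trivial
  have hspan : ∀ u ∈ Submodule.span ℂ {v : HilbertTensor H₁ E |
      ∃ (A : H₁ →L[ℂ] H₁) (ψ : H₂), v = amplification E A (V ψ)},
      Tendsto (fun s => truncation H₁ e s u) atTop (𝓝 u) := by
    intro u hu
    induction hu using Submodule.span_induction with
    | mem u hu =>
      obtain ⟨A, ψ, rfl⟩ := hu
      simp only [truncation_amplification]
      exact ((amplification E A).continuous.tendsto _).comp (tendsto_truncation_isometry he hW ψ)
    | zero => simp
    | add u u' _ _ hu hu' => simpa using hu.add hu'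
    | smul c u _ hu => simpa using hu.const_smul c
  rw [Metric.tendsto_nhds]
  intro ε hε
  obtain ⟨u, hu, huv⟩ := Metric.mem_closure_iff.1 hv (ε / 3) (by positivity)
  filter_upwards [Metric.tendsto_nhds.1 (hspan u hu) (ε / 3) (by positivity)] with s hs
  have h1 : dist (truncation H₁ e s v) (truncation H₁ e s u) ≤ dist v u := by
    rw [dist_eq_norm, dist_eq_norm, ← map_sub]
    exact he.norm_truncation_apply_le s _
  calc _ ≤ dist (truncation H₁ e s v) (truncation H₁ e s u) + dist (truncation H₁ e s u) u
        + dist u v := dist_triangle4 _ _ _ _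
    _ < ε := by rw [dist_comm u v]; linarith

end Kraus

/-! ### From a kernel to complete domination -/

section KernelToDomination

variable {H₁ H₂ E X : Type*} [NormedAddCommGroup H₁] [InnerProductSpace ℂ H₁] [CompleteSpace H₁]
  [NormedAddCommGroup H₂] [InnerProductSpace ℂ H₂] [CompleteSpace H₂]
  [NormedAddCommGroup E] [InnerProductSpace ℂ E] [CompleteSpace E]
  {S T : (H₁ →L[ℂ] H₁) →ₗ[ℂ] (H₂ →L[ℂ] H₂)}
  {V : H₂ →L[ℂ] HilbertTensor H₁ E} {W : X → H₂ →L[ℂ] H₁}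

theorem IsCanonicalStinespringDilation.tendsto_sum_inner_kraus
    (hV : IsCanonicalStinespringDilation T V) (hW : IsInducedKrausFamily V W)
    (A : H₁ →L[ℂ] H₁) (ψ φ : H₂) :
    Tendsto (fun s : Finset X => ∑ x ∈ s, ⟪W x ψ, A (W x φ)⟫_ℂ) atTop (𝓝 ⟪ψ, T A φ⟫_ℂ) := by
  obtain ⟨e, he, hW⟩ := hW
  have h : ⟪ψ, T A φ⟫_ℂ = ⟪V ψ, amplification E A (V φ)⟫_ℂ := by
    rw [hV.dilation, ContinuousLinearMap.comp_apply, ContinuousLinearMap.adjoint_inner_right,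
      ContinuousLinearMap.comp_apply]
  rw [h]
  have hlim := ((innerSL ℂ (V ψ) ∘L amplification E A).continuous.tendsto _).comp
    (tendsto_truncation_isometry he hW φ)
  refine hlim.congr fun s => ?_
  simp only [Function.comp_apply, ContinuousLinearMap.comp_apply, innerSL_apply_apply,
    truncation_apply, map_sum, amplification_tensorRight,
    adjoint_tensorRight_comp_eq_of_hasSum he hW]
  refine Finset.sum_congr rfl fun x _ => ?_
  rw [← ContinuousLinearMap.adjoint_inner_left, adjoint_tensorRight_comp_eq_of_hasSum he hW]

theorem HasStrongDoubleSum.tendsto_sum_inner {K : X → X → ℂ} {A : H₁ →L[ℂ] H₁} {R : H₂ →L[ℂ] H₂}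
    (h : HasStrongDoubleSum
      (fun x y => K x y • ((ContinuousLinearMap.adjoint (W x)) ∘L A ∘L (W y))) R) (ψ φ : H₂) :
    Tendsto (fun s : Finset X => ∑ x ∈ s, ∑ y ∈ s, K x y * ⟪W x ψ, A (W y φ)⟫_ℂ) atTop
      (𝓝 ⟪ψ, R φ⟫_ℂ) := by
  have hlim := ((innerSL ℂ ψ).continuous.tendsto _).comp ((h φ).comp tendsto_atTop_diagonal)
  refine hlim.congr fun s => ?_
  simp [inner_sum, inner_smul_right, ContinuousLinearMap.adjoint_inner_right]

/-- `T` is represented by the Kronecker kernel and so `T - S` by `L = I - K`. On `B* B` its quadratic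
form is a limit of finite pairings of `L` with Gram matrices. -/
theorem completelyDominated_of_kernel (hS : S ∈ CP H₁ H₂) (hT : T ∈ CP H₁ H₂)
    (hV : IsCanonicalStinespringDilation T V) (hW : IsInducedKrausFamily V W) {K : X → X → ℂ}
    (hK : KernelLE K (kroneckerKernel X))
    (hSK : ∀ A : H₁ →L[ℂ] H₁, HasStrongDoubleSum
      (fun x y => K x y • ((ContinuousLinearMap.adjoint (W x)) ∘L A ∘L (W y))) (S A)) :
    CompletelyDominated S T := by
  classical
  refine completelyDominated_of_sum_inner_nonneg hS hT fun k B η => ?_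
  set L := kroneckerKernel X - K with hL
  have hlim (A : H₁ →L[ℂ] H₁) (ψ φ : H₂) :
      Tendsto (fun s : Finset X => ∑ x ∈ s, ∑ y ∈ s, L x y * ⟪W x ψ, A (W y φ)⟫_ℂ) atTop
        (𝓝 ⟪ψ, (T - S) A φ⟫_ℂ) := by
    have h := (hV.tendsto_sum_inner_kraus hW A ψ φ).sub ((hSK A).tendsto_sum_inner ψ φ)
    rw [← inner_sub_right] at h
    refine h.congr fun s => ?_
    rw [← Finset.sum_sub_distrib]
    refine Finset.sum_congr rfl fun x hx => ?_
    simp [hL, kroneckerKernel, sub_mul, hx]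
  refine ge_of_tendsto' (tendsto_finsetSum _ fun i _ => tendsto_finsetSum _ fun j _ =>
    hlim ((star B * B) i j) (η i) (η j)) fun s => ?_
  have hswap : ∑ i, ∑ j, ∑ x ∈ s, ∑ y ∈ s, L x y * ⟪W x (η i), (star B * B) i j (W y (η j))⟫_ℂ =
      ∑ l, ∑ x ∈ s, ∑ y ∈ s, L x y * ⟪CStarMatrix.applyVec B (fun i => W x (η i)) l,
        CStarMatrix.applyVec B (fun i => W y (η i)) l⟫_ℂ := by
    calc _ = ∑ x ∈ s, ∑ y ∈ s, L x y * ∑ i, ⟪W x (η i),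
            CStarMatrix.applyVec (star B * B) (fun i => W y (η i)) i⟫_ℂ := by
          simp only [CStarMatrix.applyVec, inner_sum, Finset.mul_sum]
          simp only [Finset.sum_comm (s := Finset.univ) (t := s)]
      _ = _ := by
          simp only [CStarMatrix.sum_inner_star_mul_self, Finset.mul_sum]
          rw [Finset.sum_comm_cycle]
  rw [hswap]
  exact Finset.sum_nonneg fun l _ => hK.sum_mul_inner_nonneg s _

end KernelToDomination

/-! ### The Radon–Nikodym operator of a dominated map -/

section RadonNikodym

variable {H₁ H₂ : Type*} [NormedAddCommGroup H₁] [InnerProductSpace ℂ H₁] [CompleteSpace H₁]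
  [NormedAddCommGroup H₂] [InnerProductSpace ℂ H₂] [CompleteSpace H₂]
  {S T : (H₁ →L[ℂ] H₁) →ₗ[ℂ] (H₂ →L[ℂ] H₂)}

/-- The operator-valued kernel `(A, B) ↦ S (A* B)` on `B(H₁)`. -/
noncomputable def stinespringKernel (S : (H₁ →L[ℂ] H₁) →ₗ[ℂ] (H₂ →L[ℂ] H₂)) :
    Matrix (H₁ →L[ℂ] H₁) (H₁ →L[ℂ] H₁) (H₂ →L[ℂ] H₂) :=
  Matrix.of fun A B => S (star A * B)

theorem sum_inner_finsupp_nonneg_of_mem_CP (hS : S ∈ CP H₁ H₂) (u : (H₁ →L[ℂ] H₁) →₀ H₂) :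
    0 ≤ u.sum fun A ψ => u.sum fun B φ => ⟪ψ, S (star A * B) φ⟫_ℂ := by
  have h := sum_inner_nonneg_of_mem_CP hS (fun A : u.support => (A : H₁ →L[ℂ] H₁)) fun A => u A
  simpa only [Finsupp.sum, ← Finset.sum_coe_sort u.support] using h

theorem posSemidef_stinespringKernel (hS : S ∈ CP H₁ H₂) : (stinespringKernel S).PosSemidef := by
  have htfae := (RKHS.posSemidef_tfae (K := stinespringKernel S)).out 0 2
  refine htfae.2 ⟨?_, fun u => ?_⟩
  · ext1 A B
    simp [stinespringKernel, ← map_star_of_mem_CP hS]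
  · have h := (RCLike.nonneg_iff.1 (sum_inner_finsupp_nonneg_of_mem_CP hS u)).1
    have h2 : (u.sum fun A ψ => u.sum fun B φ => ⟪ψ, S (star A * B) φ⟫_ℂ) =
        star (u.sum fun A ψ => u.sum fun B φ => ⟪stinespringKernel S B A ψ, φ⟫_ℂ) := by
      simp only [Finsupp.sum, star_sum, RCLike.star_def, inner_conj_symm]
      rw [Finset.sum_comm]
      rfl
    rw [h2, RCLike.star_def, RCLike.conj_re] at h
    exact h

/-- The Kolmogorov decomposition of the kernel `(A, B) ↦ S (A* B)`, realized on its reproducing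
kernel Hilbert space. -/
theorem exists_kolmogorov_decomposition.{u, v} {H₁ : Type u} {H₂ : Type v}
    [NormedAddCommGroup H₁] [InnerProductSpace ℂ H₁] [CompleteSpace H₁]
    [NormedAddCommGroup H₂] [InnerProductSpace ℂ H₂] [CompleteSpace H₂]
    {S : (H₁ →L[ℂ] H₁) →ₗ[ℂ] (H₂ →L[ℂ] H₂)} (hS : S ∈ CP H₁ H₂) :
    ∃ (𝓚 : Type (max u v)) (_ : NormedAddCommGroup 𝓚) (_ : InnerProductSpace ℂ 𝓚)
      (_ : CompleteSpace 𝓚) (k : (H₁ →L[ℂ] H₁) → H₂ →L[ℂ] 𝓚),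
      ∀ A B ψ φ, ⟪k A ψ, k B φ⟫_ℂ = ⟪ψ, S (star A * B) φ⟫_ℂ := by
  have : Fact (stinespringKernel S).PosSemidef := ⟨posSemidef_stinespringKernel hS⟩
  refine ⟨RKHS.OfKernel (stinespringKernel S), inferInstance, inferInstance, inferInstance,
    fun A => RKHS.kerFun _ A, fun A B ψ φ => ?_⟩
  rw [← inner_conj_symm, ← RKHS.kernel_inner, RKHS.OfKernel.kernel_ofKernel, inner_conj_symm]
  rfl

theorem IsCanonicalStinespringDilation.induction {E : Type*} [NormedAddCommGroup E]
    [InnerProductSpace ℂ E] [CompleteSpace E] {V : H₂ →L[ℂ] HilbertTensor H₁ E}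
    (hV : IsCanonicalStinespringDilation T V) {p : HilbertTensor H₁ E → Prop}
    (hp : IsClosed {v | p v}) (hadd : ∀ u v, p u → p v → p (u + v))
    (hV_mem : ∀ A ψ, p (amplification E A (V ψ))) (v) : p v := by
  let D : Submodule ℂ (HilbertTensor H₁ E) := Submodule.span ℂ {v : HilbertTensor H₁ E |
    ∃ (A : H₁ →L[ℂ] H₁) (ψ : H₂), v = amplification E A (V ψ)}
  have hD : ∀ v ∈ D, p v := fun v hv => by
    induction hv using Submodule.closure_induction with
    | zero => simpa using hV_mem 0 0
    | add u v _ _ hu hv => exact hadd u v hu hv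
    | smul_mem c u hu =>
      obtain ⟨A, ψ, rfl⟩ := hu
      rw [← map_smul, ← map_smul]
      exact hV_mem A (c • ψ)
  have hv : v ∈ closure (D : Set (HilbertTensor H₁ E)) := by
    rw [← Submodule.topologicalClosure_coe, hV.minimal]; trivial
  exact closure_minimal hD hp hv

/-- If `S ≤ T`, then on the space `H₁ ⊗ E` of a minimal dilation of `T` there is an operator
`0 ≤ R ≤ 1` in the commutant of the amplification with `S(A) = V* R (A ⊗ 1) V`. It is `G* G`,
where `G` is the contraction `(A ⊗ 1) V ψ ↦ k_A ψ` into the reproducing kernel Hilbert space of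
`(A, B) ↦ S (A* B)` with kernel functions `k_A`. -/
theorem IsCanonicalStinespringDilation.exists_radonNikodym {E : Type*} [NormedAddCommGroup E]
    [InnerProductSpace ℂ E] [CompleteSpace E] {V : H₂ →L[ℂ] HilbertTensor H₁ E}
    (hV : IsCanonicalStinespringDilation T V) (hS : S ∈ CP H₁ H₂)
    (hST : CompletelyDominated S T) :
    ∃ R : HilbertTensor H₁ E →L[ℂ] HilbertTensor H₁ E,
      (∀ v, 0 ≤ ⟪v, R v⟫_ℂ) ∧ (∀ v, 0 ≤ ⟪v, v - R v⟫_ℂ) ∧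
      (∀ A v, R (amplification E A v) = amplification E A (R v)) ∧
      ∀ A ψ, S A ψ = V.adjoint (R (amplification E A (V ψ))) := by
  obtain ⟨𝓚, _, _, _, k, hk⟩ := exists_kolmogorov_decomposition hS
  let Γ : ((H₁ →L[ℂ] H₁) →₀ H₂) →ₗ[ℂ] HilbertTensor H₁ E :=
    Finsupp.lsum ℂ fun A => (amplification E A ∘L V : H₂ →ₗ[ℂ] HilbertTensor H₁ E)
  let F : ((H₁ →L[ℂ] H₁) →₀ H₂) →ₗ[ℂ] 𝓚 := Finsupp.lsum ℂ fun A => (k A : H₂ →ₗ[ℂ] 𝓚)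
  have hΓs (A : H₁ →L[ℂ] H₁) (ψ : H₂) : Γ (Finsupp.single A ψ) = amplification E A (V ψ) := by
    simp [Γ]
  have hFs (A : H₁ →L[ℂ] H₁) (ψ : H₂) : F (Finsupp.single A ψ) = k A ψ := by simp [F]
  have hΓ : DenseRange Γ := by
    have hle : Submodule.span ℂ {v : HilbertTensor H₁ E | ∃ (A : H₁ →L[ℂ] H₁) (ψ : H₂),
        v = amplification E A (V ψ)} ≤ LinearMap.range Γ := by
      rw [Submodule.span_le]
      rintro _ ⟨A, ψ, rfl⟩
      exact ⟨Finsupp.single A ψ, hΓs A ψ⟩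
    exact (Submodule.dense_iff_topologicalClosure_eq_top.2 hV.minimal).mono hle
  have hdil (A B : H₁ →L[ℂ] H₁) (ψ φ : H₂) :
      ⟪amplification E A (V ψ), amplification E B (V φ)⟫_ℂ = ⟪ψ, T (star A * B) φ⟫_ℂ := by
    rw [hV.dilation, ContinuousLinearMap.comp_apply, ContinuousLinearMap.adjoint_inner_right,
      ContinuousLinearMap.comp_apply, amplification_mul, inner_amplification_right,
      inner_amplification_right, inner_amplification_right, star_star]
  have hbound (u) : ‖F u‖ ≤ 1 * ‖Γ u‖ := by
    have h := (RCLike.nonneg_iff.1 (sum_inner_finsupp_nonneg_of_mem_CP hST u)).1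
    have h1 : (u.sum fun A ψ => u.sum fun B φ => ⟪ψ, (T - S) (star A * B) φ⟫_ℂ) =
        ⟪Γ u, Γ u⟫_ℂ - ⟪F u, F u⟫_ℂ := by
      simp only [Γ, F, Finsupp.lsum_apply, Finsupp.sum, sum_inner, inner_sum,
        ContinuousLinearMap.coe_coe, ContinuousLinearMap.comp_apply, hk, hdil,
        ← Finset.sum_sub_distrib, ← inner_sub_right]
      rw [Finset.sum_comm]
      rfl
    rw [h1, map_sub, inner_self_eq_norm_sq, inner_self_eq_norm_sq] at h
    rw [one_mul]
    exact (sq_le_sq₀ (norm_nonneg _) (norm_nonneg _)).1 (by linarith)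
  let G : HilbertTensor H₁ E →L[ℂ] 𝓚 := F.extendOfNorm Γ
  have hG (A : H₁ →L[ℂ] H₁) (ψ : H₂) : G (amplification E A (V ψ)) = k A ψ := by
    rw [← hΓs, ← hFs]
    exact LinearMap.extendOfNorm_eq hΓ ⟨1, hbound⟩ _
  have hG1 (v : HilbertTensor H₁ E) : ‖G v‖ ≤ ‖v‖ := by
    simpa using LinearMap.norm_extendOfNorm_apply_le hΓ 1 hbound v
  refine ⟨G.adjoint ∘L G, fun v => ?_, fun v => ?_, fun A v => ?_, fun A ψ => ?_⟩
  · rw [ContinuousLinearMap.comp_apply, ContinuousLinearMap.adjoint_inner_right,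
      inner_self_eq_norm_sq_to_K]
    positivity
  · rw [inner_sub_right, ContinuousLinearMap.comp_apply, ContinuousLinearMap.adjoint_inner_right,
      inner_self_eq_norm_sq_to_K, inner_self_eq_norm_sq_to_K, sub_nonneg]
    have := pow_le_pow_left₀ (norm_nonneg _) (hG1 v) 2
    exact_mod_cast this
  · refine ext_inner_left ℂ fun w => ?_
    rw [inner_amplification_right]
    simp only [ContinuousLinearMap.comp_apply, ContinuousLinearMap.adjoint_inner_right]
    induction w using hV.induction with
    | hp => exact isClosed_eq (by fun_prop) (by fun_prop)
    | hadd u v hu hv => simp only [map_add, inner_add_left, hu, hv]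
    | hV_mem B ψ =>
      induction v using hV.induction with
      | hp => exact isClosed_eq (by fun_prop) (by fun_prop)
      | hadd u v hu hv => simp only [map_add, inner_add_right, hu, hv]
      | hV_mem C φ =>
        simp only [← amplification_mul, hG, hk, star_mul, star_star, mul_assoc]
  · refine ext_inner_left ℂ fun φ => ?_
    have h1 := hG 1 φ
    rw [amplification_one] at h1
    rw [ContinuousLinearMap.adjoint_inner_right, ContinuousLinearMap.comp_apply,
      ContinuousLinearMap.adjoint_inner_right, hG, h1, hk, star_one, one_mul]

end RadonNikodym

/-! ### From the Radon–Nikodym operator to the kernel -/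

section DominationToKernel

/-- The centre of `B(H)` consists of the scalars. -/
theorem exists_eq_smul_of_commute {H : Type*} [NormedAddCommGroup H] [InnerProductSpace ℂ H]
    {B : H →L[ℂ] H} (hB : ∀ (A : H →L[ℂ] H) (φ : H), B (A φ) = A (B φ)) :
    ∃ c : ℂ, ∀ φ, B φ = c • φ := by
  rcases subsingleton_or_nontrivial H with h | h
  · exact ⟨0, fun φ => Subsingleton.elim _ _⟩
  obtain ⟨φ₀, hφ₀⟩ := exists_ne (0 : H)
  have hn : ⟪φ₀, φ₀⟫_ℂ ≠ 0 := inner_self_ne_zero.2 hφ₀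
  refine ⟨⟪φ₀, B φ₀⟫_ℂ / ⟪φ₀, φ₀⟫_ℂ, fun φ => ?_⟩
  -- `B` commutes with the rank-one operator `|φ⟩⟨φ₀|`.
  have h := hB ((innerSL ℂ φ₀).smulRight φ) φ₀
  simp only [ContinuousLinearMap.smulRight_apply, innerSL_apply_apply, map_smul] at h
  rw [div_eq_inv_mul, mul_smul, ← h, smul_smul, inv_mul_cancel₀ hn, one_smul]

variable {H E X : Type*} [NormedAddCommGroup H] [InnerProductSpace ℂ H] [CompleteSpace H]
  [NormedAddCommGroup E] [InnerProductSpace ℂ E]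

/-- The matrix entries along a family of vectors of `E` of an operator on `H ⊗ E` in the commutant
of the amplification are scalars. -/
theorem exists_kernel_of_commute (e : X → E)
    {R : HilbertTensor H E →L[ℂ] HilbertTensor H E}
    (hR : ∀ A v, R (amplification E A v) = amplification E A (R v)) :
    ∃ K : X → X → ℂ, ∀ x y φ,
      (tensorRight H (e x)).adjoint (R (tensorRight H (e y) φ)) = K x y • φ := by
  have h (x y : X) := exists_eq_smul_of_commute
    (B := (tensorRight H (e x)).adjoint ∘L R ∘L tensorRight H (e y)) fun A φ => by
      simp only [ContinuousLinearMap.comp_apply]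
      rw [← amplification_tensorRight, hR, adjoint_tensorRight_amplification]
  choose K hK using h
  exact ⟨K, hK⟩

/-- Compression by the family `φ ↦ φ ⊗ e x` turns positivity of `R` into positivity of the kernel of
its matrix entries, evaluated on a single unit vector `φ`. -/
theorem isPosDefKernel_of_inner_nonneg [Nontrivial H] {e : X → E}
    {R : HilbertTensor H E →L[ℂ] HilbertTensor H E} (hR : ∀ v, 0 ≤ ⟪v, R v⟫_ℂ) {K : X → X → ℂ}
    (hK : ∀ x y φ, (tensorRight H (e x)).adjoint (R (tensorRight H (e y) φ)) = K x y • φ) :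
    IsPosDefKernel K := by
  intro n x c
  obtain ⟨φ, hφ⟩ := exists_norm_eq H zero_le_one
  have h := hR (∑ i, c i • tensorRight H (e (x i)) φ)
  simp only [map_sum, map_smul, sum_inner, inner_sum, inner_smul_left, inner_smul_right,
    ← ContinuousLinearMap.adjoint_inner_right, hK, inner_self_eq_norm_sq_to_K, hφ] at h
  simp only [Finset.mul_sum] at h
  rw [Finset.sum_comm] at h
  simpa [mul_assoc, mul_left_comm] using h

theorem Orthonormal.isPosDefKernel_kroneckerKernel {e : X → E} (he : Orthonormal ℂ e) :
    IsPosDefKernel (kroneckerKernel X) := by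
  classical
  intro n x c
  have h : ∑ i, ∑ j, (starRingEnd ℂ) (c i) * c j * kroneckerKernel X (x i) (x j) =
      ⟪∑ i, c i • e (x i), ∑ i, c i • e (x i)⟫_ℂ := by
    simp only [sum_inner, inner_sum, inner_smul_left, inner_smul_right, Finset.mul_sum,
      orthonormal_iff_ite.1 he, kroneckerKernel]
    rw [Finset.sum_comm]
    simp only [mul_assoc, mul_left_comm]
  rw [h, inner_self_eq_norm_sq_to_K]
  positivity

variable {H₂ : Type*} [NormedAddCommGroup H₂] [InnerProductSpace ℂ H₂] [CompleteSpace H₂]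
  [CompleteSpace E] {S T : (H →L[ℂ] H) →ₗ[ℂ] (H₂ →L[ℂ] H₂)}
  {V : H₂ →L[ℂ] HilbertTensor H E} {W : X → H₂ →L[ℂ] H}

/-- The kernel consists of the matrix entries along the system `e` of the Radon–Nikodym operator `R`
of `S`. The partial sum over the rectangle `s × t` is `V* P_s R P_t (A ⊗ 1) V`, where the truncations
`P_s`, `P_t` tend strongly to `1`. -/
theorem exists_kernel_of_completelyDominated (hS : S ∈ CP H H₂)
    (hV : IsCanonicalStinespringDilation T V) (hW : IsInducedKrausFamily V W)
    (hST : CompletelyDominated S T) :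
    ∃ K : X → X → ℂ, IsPosDefKernel K ∧ KernelLE K (kroneckerKernel X) ∧
      ∀ A : H →L[ℂ] H, HasStrongDoubleSum
        (fun x y => K x y • ((ContinuousLinearMap.adjoint (W x)) ∘L A ∘L (W y))) (S A) := by
  obtain ⟨e, he, hWe⟩ := hW
  obtain ⟨R, hR0, hR1, hRA, hRS⟩ := hV.exists_radonNikodym hS hST
  rcases subsingleton_or_nontrivial H with h | h
  · -- On `H = 0` the entries of `R` do not determine scalars; the zero kernel represents `S = 0`.
    refine ⟨0, by simp [IsPosDefKernel], ?_, fun A η => ?_⟩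
    · rw [KernelLE, sub_zero]
      exact he.isPosDefKernel_kroneckerKernel
    · have : A = 0 := Subsingleton.elim _ _
      simpa [this] using tendsto_const_nhds
  obtain ⟨K, hK⟩ := exists_kernel_of_commute e hRA
  refine ⟨K, isPosDefKernel_of_inner_nonneg hR0 hK, ?_, fun A η => ?_⟩
  · refine isPosDefKernel_of_inner_nonneg (R := 1 - R) (e := e) (by simpa using hR1)
      fun x y φ => ?_
    classical
    simp [hK, adjoint_tensorRight_apply_tensorRight, orthonormal_iff_ite.1 he, kroneckerKernel,
      sub_smul]
  · set ζ := amplification E A (V η) with hζ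
    have hP := hV.tendsto_truncation he hWe
    have hfst : Tendsto Prod.fst (atTop : Filter (Finset X × Finset X)) atTop := by
      rw [← prod_atTop_atTop_eq]; exact tendsto_fst
    have hsnd : Tendsto Prod.snd (atTop : Filter (Finset X × Finset X)) atTop := by
      rw [← prod_atTop_atTop_eq]; exact tendsto_snd
    have hlim : Tendsto (fun p : Finset X × Finset X =>
        truncation H e p.1 (R (truncation H e p.2 ζ))) atTop (𝓝 (R ζ)) := by
      have h2 : Tendsto (fun p : Finset X × Finset X => R (truncation H e p.2 ζ - ζ)) atTop
          (𝓝 0) := by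
        have := (hP ζ).sub_const ζ
        rw [sub_self] at this
        have hR := (R.continuous.tendsto _).comp (this.comp hsnd)
        rwa [map_zero] at hR
      have h3 : Tendsto (fun p : Finset X × Finset X =>
          truncation H e p.1 (R (truncation H e p.2 ζ - ζ))) atTop (𝓝 0) :=
        squeeze_zero_norm (fun p => he.norm_truncation_apply_le _ _)
          (by simpa using h2.norm)
      have h4 := h3.add ((hP (R ζ)).comp hfst)
      rw [zero_add] at h4
      exact h4.congr fun p => by simp
    have hfin := (V.adjoint.continuous.tendsto _).comp hlim
    rw [← hRS] at hfin
    refine hfin.congr fun p => ?_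
    simp only [Function.comp_apply, truncation_apply, map_sum]
    rw [Finset.sum_comm]
    refine Finset.sum_congr rfl fun x _ => Finset.sum_congr rfl fun y _ => ?_
    refine ext_inner_left ℂ fun ψ => ?_
    rw [hζ, adjoint_tensorRight_amplification, adjoint_tensorRight_comp_eq_of_hasSum he hWe, hK,
      ContinuousLinearMap.adjoint_inner_right, ← ContinuousLinearMap.adjoint_inner_left,
      adjoint_tensorRight_comp_eq_of_hasSum he hWe, smul_apply,
      inner_smul_right, inner_smul_right, ContinuousLinearMap.comp_apply,
      ContinuousLinearMap.adjoint_inner_right, ContinuousLinearMap.comp_apply]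

end DominationToKernel

/-! ### The Radon–Nikodym theorem -/

theorem mainTheorem4 {H₁ H₂ E X : Type*}
    [NormedAddCommGroup H₁] [InnerProductSpace ℂ H₁] [CompleteSpace H₁]
    [NormedAddCommGroup H₂] [InnerProductSpace ℂ H₂] [CompleteSpace H₂]
    [NormedAddCommGroup E] [InnerProductSpace ℂ E] [CompleteSpace E]
    (S T : (H₁ →L[ℂ] H₁) →ₗ[ℂ] (H₂ →L[ℂ] H₂)) (hS : S ∈ CP H₁ H₂) (hT : T ∈ CP H₁ H₂)
    (V : H₂ →L[ℂ] HilbertTensor H₁ E) (hV : IsCanonicalStinespringDilation T V)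
    (W : X → H₂ →L[ℂ] H₁) (hW : IsInducedKrausFamily V W) :
    CompletelyDominated S T ↔
      ∃ K : X → X → ℂ, IsPosDefKernel K ∧ KernelLE K (kroneckerKernel X) ∧
        ∀ A : H₁ →L[ℂ] H₁, HasStrongDoubleSum
          (fun x y => K x y • ((ContinuousLinearMap.adjoint (W x)) ∘L A ∘L (W y))) (S A) :=
  ⟨exists_kernel_of_completelyDominated hS hV hW,
    fun ⟨_, _, hK, hSK⟩ => completelyDominated_of_kernel hS hT hV hW hK hSK⟩
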